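/- Throughout, $h:\mathbb R^d\to\mathbb R\cup\{\infty\}$ is a proper, closed (lower semicontinuous) convex function, $\operatorname{dom}h=\{x: h(x)<\infty\}$, and $h^*(x^*)=\sup\{\langle x,x^*\rangle-h(x): x\in\operatorname{dom}h\}$ is its convex conjugate. Such an $h$ is *Legendre convex* if $\operatorname{int}(\operatorname{dom}h)\neq\emptyset$; $h$ is differentiable on $\operatorname{int}(\operatorname{dom}h)$, with $\|\nabla h(x_i)\|\to\infty$ whenever $x_i\in\operatorname{int}(\operatorname{dom}h)$ is a sequence converging to a boundary point of $\operatorname{int}(\operatorname{dom}h)$; and $h$ is strictly convex on $\operatorname{int}(\operatorname{dom}h)$. For proper closed convex $h,g$, a convex set $Q\subseteq\operatorname{dom}h\cap\operatorname{dom}g$ and $L,\mu\ge 0$, $h$ is *$L$-smooth relative to $g$ on $Q$* if the function equal to $Lg-h$ on $Q$ and to $\infty$ off $Q$ is convex, and $h$ is *$\mu$-strongly convex relative to $g$ on $Q$* if the function equal to $h-\mu g$ on $Q$ and to $\infty$ off $Q$ is convex. $\preceq$ is the Loewner order on symmetric matrices. **Proposition.** Let $f:\mathbb R^d\to\mathbb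 R\cup\{\infty\}$ be Legendre convex, minimized at $x_{\min}$, and $C^2$ on $\operatorname{int}(\operatorname{dom}f)\setminus\{x_{\min}\}$, with $\det\nabla^2 f(x)\neq0$ for all $x\in\operatorname{int}(\operatorname{dom}f)\setminus\{x_{\min}\}$. Let $k:\mathbb R^d\to\mathbb R\cup\{\infty\}$ be Legendre convex, and finite and $C^2$ on $\operatorname{int}(\operatorname{dom}f^*)\setminus\{0\}$, with $\det\nabla^2 k(x^*)\neq0$ for all $x^*\in\operatorname{int}(\operatorname{dom}f^*)\setminus\{0\}$. Let $L^*,\mu^*\ge0$. 1. $k$ is $L^*$-smooth relative to $f^*$ on $\operatorname{int}(\operatorname{dom}f^*)$ if and only if $$\nabla^2 f(x)\preceq L^*[\nabla^2k(\nabla f(x))]^{-1}\qquad\text{for all }x\in\operatorname{int}(\operatorname{dom}f)\setminus\{x_{\min}\}.$$ 2. $k$ is $\mu^*$-strongly convex relative to $f^*$ on $\operatorname{int}(\operatorname{dom}f^*)$ if and only if $$\mu^*[\nabla^2k(\nabla f(x))]^{-1}\preceq\nabla^2 f(x)\qquad\text{for all }x\in\operatorname{int}(\operatorname{dom}f)\setminus\{x_{\min}\}.$$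 -/

import Mathlib

open Set Filter Topology

noncomputable section

namespace DualPrecond

/-- Euclidean space `ℝ^d`. -/
abbrev Eucl (d : ℕ) : Type := EuclideanSpace ℝ (Fin d)

variable {d : ℕ}

/-- The effective domain `{x : h x < ∞}`. -/
def dom (h : Eucl d → EReal) : Set (Eucl d) := {x | h x < ⊤}

/-- The real-valued representative of `h`; it agrees with `h` wherever `h` is finite. -/
def re (h : Eucl d → EReal) : Eucl d → ℝ := fun x => (h x).toReal

/-- `h` is proper: it takes values in `ℝ ∪ {∞}` and is not identically `∞`. -/
def IsProper (h : Eucl d → EReal) : Prop := (∀ x, h x ≠ ⊥) ∧ ∃ x, h x ≠ ⊤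

/-- `h` is a convex extended-real-valued function: its epigraph is convex. -/
def IsConvex (h : Eucl d → EReal) : Prop :=
  Convex ℝ {p : Eucl d × ℝ | h p.1 ≤ (p.2 : EReal)}

/-- The convex conjugate `h^*(y) = sup {⟨x, y⟩ - h x : x ∈ dom h}`. -/
def conj (h : Eucl d → EReal) : Eucl d → EReal :=
  fun y => ⨆ x ∈ dom h, ((inner ℝ x y : ℝ) : EReal) - h x

/-- The gradient `∇ h`, meaningful at interior points of `dom h` where `h` is differentiable. -/
def grad (h : Eucl d → EReal) : Eucl d → Eucl d := fun x => gradient (re h) x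

/-- The Hessian `∇² h x`, as a linear operator: the derivative of the gradient map. -/
def hess (h : Eucl d → EReal) (x : Eucl d) : Eucl d →L[ℝ] Eucl d := fderiv ℝ (grad h) x

/-- `h` is `C²` on the (open) set `U`: it is finite there, and its real values
are twice continuously differentiable. -/
def IsC2On (h : Eucl d → EReal) (U : Set (Eucl d)) : Prop :=
  U ⊆ dom h ∧ ContDiffOn ℝ 2 (re h) U

/-- Essentially smooth convex functions (proper and closed by convention). -/
structure IsEssentiallySmooth (h : Eucl d → EReal) : Prop where
  proper : IsProper h
  closed : LowerSemicontinuous h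
  convex : IsConvex h
  nonempty_interior : (interior (dom h)).Nonempty
  differentiable : ∀ x ∈ interior (dom h), DifferentiableAt ℝ (re h) x
  steep : ∀ (x : ℕ → Eucl d) (b : Eucl d), (∀ i, x i ∈ interior (dom h)) →
    b ∈ frontier (interior (dom h)) → Tendsto x atTop (𝓝 b) →
    Tendsto (fun i => ‖grad h (x i)‖) atTop atTop

/-- Legendre convex functions: essentially smooth, and strictly convex on the interior
of the domain. -/
structure IsLegendre (h : Eucl d → EReal) : Prop extends IsEssentiallySmooth h where
  strictConvex : StrictConvexOn ℝ (interior (dom h)) (re h)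

open Classical in
/-- `h` is `L`-smooth relative to `g` on the convex set `Q ⊆ dom h ∩ dom g`: the function equal to
`L g - h` on `Q` and to `∞` off `Q` is convex. -/
def IsRelSmoothOn (L : ℝ) (h g : Eucl d → EReal) (Q : Set (Eucl d)) : Prop :=
  Q ⊆ dom h ∩ dom g ∧ Convex ℝ Q ∧
    IsConvex (fun x => if x ∈ Q then (L : EReal) * g x - h x else ⊤)

open Classical in
/-- `h` is `μ`-strongly convex relative to `g` on the convex set `Q ⊆ dom h ∩ dom g`: the function
equal to `h - μ g` on `Q` and to `∞` off `Q` is convex. -/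
def IsRelStronglyConvexOn (μ : ℝ) (h g : Eucl d → EReal) (Q : Set (Eucl d)) : Prop :=
  Q ⊆ dom h ∩ dom g ∧ Convex ℝ Q ∧
    IsConvex (fun x => if x ∈ Q then h x - (μ : EReal) * g x else ⊤)

end DualPrecond

end

/-!
The proof transports both relative convexity conditions from the dual space to the primal space
through the gradient map `∇f`, and then inverts a Loewner inequality.

Legendre duality. A subgradient of an essentially smooth `f` can only sit at an interior point of
`dom f`, since steepness is incompatible with a supporting slope at the boundary
(`IsEssentiallySmooth.mem_interior_of_isSubgradientAt`); in particular `xmin` is interior. For `y`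
interior to `dom f^*`, the function `f - ⟨·, y⟩` is coercive and attains its minimum
(`exists_isSubgradientAt`), so `∇f` maps `int (dom f)` onto `int (dom f^*)`. Strict convexity gives
linear growth of `f` above its tangent planes (`IsLegendre.exists_linear_growth`), which shows that
`∇f` takes values in `int (dom f^*)` and has a continuous inverse. It follows that `f^*` is
differentiable on `int (dom f^*)` with `∇f^* = (∇f)⁻¹` (`IsLegendre.hasGradientAt_conj`), and, where
`∇²f(x)` is invertible, that `∇²f^*(∇f(x)) = ∇²f(x)⁻¹` (`IsLegendre.hasFDerivAt_grad_conj`).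

Second-order condition. The functions `L f^* - k` and `k - μ f^*` are differentiable on
`int (dom f^*)` and twice differentiable away from `0 = ∇f(xmin)`. Such a function is convex exactly
when its Hessian is positive semidefinite away from the exceptional point
(`convexOn_iff_hessian_nonneg_off_point`); differentiability at that point is what rules out a
concave kink, which matters in dimension one. Since `∇f` matches `int (dom f) \ {xmin}` with
`int (dom f^*) \ {0}`, the two conditions read `∇²k(∇f(x)) ≤ L ∇²f(x)⁻¹` and
`μ ∇²f(x)⁻¹ ≤ ∇²k(∇f(x))`.

Inversion. Both Hessians are symmetric, positive semidefinite and invertible, so these inequalities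
can be inverted (`inner_symm_le_mul_inner_symm`, `mul_inner_symm_le_inner_symm`), which gives the
stated ones. The cases `L = 0` and `μ = 0` are covered by the same lemmas.
-/

namespace DualPrecond

/-! ### Second-order characterization of convexity off a point -/

/-- On an open interval, a differentiable function whose second derivative exists and is
nonnegative off a single point `t₀` is convex. No continuity of the derivative at `t₀` is assumed:
the function is convex on both sides of `t₀`, so its derivative is monotone up to and including
`t₀` from either side. -/
theorem convexOn_of_deriv2_nonneg_off_point {S : Set ℝ} (hSo : IsOpen S) (hS : Convex ℝ S)
    {ψ ψ' ψ'' : ℝ → ℝ} (t₀ : ℝ) (h1 : ∀ t ∈ S, HasDerivAt ψ (ψ' t) t)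
    (h2 : ∀ t ∈ S, t ≠ t₀ → HasDerivAt ψ' (ψ'' t) t) (h3 : ∀ t ∈ S, t ≠ t₀ → 0 ≤ ψ'' t) :
    ConvexOn ℝ S ψ := by
  have hc : ContinuousOn ψ S := fun t ht => (h1 t ht).continuousAt.continuousWithinAt
  have key : ∀ A ⊆ S, Convex ℝ A → (∀ t ∈ interior A, t ≠ t₀) → ConvexOn ℝ A ψ := by
    intro A hAS hA hne
    have hi : interior A ⊆ S := interior_subset.trans hAS
    exact convexOn_of_hasDerivWithinAt2_nonneg hA (hc.mono hAS)
      (fun t ht => (h1 t (hi ht)).hasDerivWithinAt)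
      (fun t ht => (h2 t (hi ht) (hne t ht)).hasDerivWithinAt)
      (fun t ht => h3 t (hi ht) (hne t ht))
  by_cases ht₀ : t₀ ∈ S
  · have hA : ConvexOn ℝ (S ∩ Iic t₀) ψ := by
      refine key _ inter_subset_left (hS.inter (convex_Iic _)) fun t ht => ?_
      rw [interior_inter, interior_Iic] at ht
      exact ht.2.ne
    have hB : ConvexOn ℝ (S ∩ Ici t₀) ψ := by
      refine key _ inter_subset_left (hS.inter (convex_Ici _)) fun t ht => ?_
      rw [interior_inter, interior_Ici] at ht
      exact ht.2.ne'
    have hAm := hA.monotoneOn_deriv fun t ht => (h1 t ht.1).differentiableAt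
    have hBm := hB.monotoneOn_deriv fun t ht => (h1 t ht.1).differentiableAt
    have hm := hAm.union_right hBm ⟨⟨ht₀, le_refl t₀⟩, fun t ht => ht.2⟩
      ⟨⟨ht₀, le_refl t₀⟩, fun t ht => ht.2⟩
    rw [← inter_union_distrib_left, Iic_union_Ici, inter_univ] at hm
    refine MonotoneOn.convexOn_of_deriv hS hc ?_ ?_
    · rw [hSo.interior_eq]
      exact fun t ht => (h1 t ht).differentiableAt.differentiableWithinAt
    · rwa [hSo.interior_eq]
  · exact key S subset_rfl hS fun t ht h => ht₀ (h ▸ interior_subset ht)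

section Hilbert

variable {E : Type*} [NormedAddCommGroup E] [InnerProductSpace ℝ E]

theorem hasDerivAt_comp_line [CompleteSpace E] {φ : E → ℝ} {G : E} {x v : E} {t : ℝ}
    (h : HasGradientAt φ G (x + t • v)) :
    HasDerivAt (fun s : ℝ => φ (x + s • v)) (inner ℝ G v) t := by
  have hl : HasDerivAt (fun s : ℝ => x + s • v) v t := by
    simpa using ((hasDerivAt_id t).smul_const v).const_add x
  have := h.hasFDerivAt.comp_hasDerivAt t hl
  rwa [InnerProductSpace.toDual_apply_apply] at this

theorem hasDerivAt_inner_comp_line {G : E → E} {H : E →L[ℝ] E} {x v : E} {t : ℝ}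
    (h : HasFDerivAt G H (x + t • v)) :
    HasDerivAt (fun s : ℝ => (inner ℝ (G (x + s • v)) v : ℝ)) (inner ℝ (H v) v) t := by
  have hl : HasDerivAt (fun s : ℝ => x + s • v) v t := by
    simpa using ((hasDerivAt_id t).smul_const v).const_add x
  simpa using (h.comp_hasDerivAt t hl).inner ℝ (hasDerivAt_const t v)

theorem hasGradientAt_lincomb [CompleteSpace E] {φ χ : E → ℝ} {G G' x : E}
    (hφ : HasGradientAt φ G x) (hχ : HasGradientAt χ G' x) (a b : ℝ) :
    HasGradientAt (fun z => a * φ z + b * χ z) (a • G + b • G') x := by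
  rw [hasGradientAt_iff_hasFDerivAt] at hφ hχ ⊢
  have h := (hφ.const_smul a).add (hχ.const_smul b)
  have e : InnerProductSpace.toDual ℝ E (a • G + b • G') =
      a • InnerProductSpace.toDual ℝ E G + b • InnerProductSpace.toDual ℝ E G' := by
    ext v
    simp
  rw [e]
  exact h

theorem convex_line_preimage {V : Set E} (hV : Convex ℝ V) (x v : E) :
    Convex ℝ {t : ℝ | x + t • v ∈ V} := by
  intro s hs t ht a b ha hb hab
  have : x + (a • s + b • t) • v = a • (x + s • v) + b • (x + t • v) := by
    have hx : x = a • x + b • x := by rw [← add_smul, hab, one_smul]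
    nth_rewrite 1 [hx]
    simp only [smul_add, add_smul, smul_smul, smul_eq_mul]
    abel
  simpa only [mem_ofPred_eq, this] using hV hs ht ha hb hab

theorem convexOn_comp_line {V : Set E} {φ : E → ℝ} (hφ : ConvexOn ℝ V φ) (x v : E) :
    ConvexOn ℝ {t : ℝ | x + t • v ∈ V} (fun t => φ (x + t • v)) := by
  refine ⟨convex_line_preimage hφ.1 x v, fun s hs t ht a b ha hb hab => ?_⟩
  have : x + (a • s + b • t) • v = a • (x + s • v) + b • (x + t • v) := by
    have hx : x = a • x + b • x := by rw [← add_smul, hab, one_smul]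
    nth_rewrite 1 [hx]
    simp only [smul_add, add_smul, smul_smul, smul_eq_mul]
    abel
  simpa only [this] using hφ.2 hs ht ha hb hab

/-- A function that is differentiable on an open convex set, and whose gradient is differentiable
off one point `p`, is convex if and only if its Hessian is positive semidefinite off `p`. -/
theorem convexOn_iff_hessian_nonneg_off_point [CompleteSpace E] {V : Set E} (hVo : IsOpen V)
    (hV : Convex ℝ V) (p : E) {φ : E → ℝ} {G : E → E} {H : E → E →L[ℝ] E}
    (hG : ∀ y ∈ V, HasGradientAt φ (G y) y) (hH : ∀ y ∈ V \ {p}, HasFDerivAt G (H y) y) :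
    ConvexOn ℝ V φ ↔ ∀ y ∈ V \ {p}, ∀ v, 0 ≤ (inner ℝ (H y v) v : ℝ) := by
  have hline : ∀ x v : E, IsOpen {t : ℝ | x + t • v ∈ V} := fun x v =>
    hVo.preimage (by fun_prop)
  constructor
  · intro hφ y hy v
    have hS := hline y v
    have h0 : (0 : ℝ) ∈ {t : ℝ | y + t • v ∈ V} := by simpa using hy.1
    have hd : ∀ t ∈ {t : ℝ | y + t • v ∈ V},
        HasDerivAt (fun s : ℝ => φ (y + s • v)) (inner ℝ (G (y + t • v)) v) t :=
      fun t ht => hasDerivAt_comp_line (hG _ ht)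
    have hm := (convexOn_comp_line hφ y v).monotoneOn_deriv
      fun t ht => (hd t ht).differentiableAt
    have hm' : MonotoneOn (fun t : ℝ => (inner ℝ (G (y + t • v)) v : ℝ))
        {t : ℝ | y + t • v ∈ V} := hm.congr fun t ht => (hd t ht).deriv
    have h2 : HasDerivAt (fun s : ℝ => (inner ℝ (G (y + s • v)) v : ℝ)) (inner ℝ (H y v) v) 0 :=
      hasDerivAt_inner_comp_line (by simpa using hH y hy)
    have h3 := hm'.derivWithin_nonneg (x := 0)
    rwa [derivWithin_of_isOpen hS h0, h2.deriv] at h3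
  · intro hpos
    refine ⟨hV, fun x hx y hy a b ha hb hab => ?_⟩
    rcases eq_or_ne x y with rfl | hxy
    · rw [← add_smul, ← add_smul, hab, one_smul, one_smul]
    have hv : y - x ≠ 0 := sub_ne_zero.2 hxy.symm
    -- the line through `x` and `y` meets `p` for at most one parameter
    obtain ⟨t₀, ht₀⟩ : ∃ t₀ : ℝ, ∀ t, t ≠ t₀ → x + t • (y - x) ≠ p := by
      by_cases h : ∃ t₀ : ℝ, x + t₀ • (y - x) = p
      · obtain ⟨t₀, rfl⟩ := h
        refine ⟨t₀, fun t ht h => ht ?_⟩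
        exact smul_left_injective ℝ hv (add_left_cancel h)
      · exact ⟨0, fun t _ h' => h ⟨t, h'⟩⟩
    have hc := convexOn_of_deriv2_nonneg_off_point (hline x (y - x))
      (convex_line_preimage hV x (y - x)) t₀
      (fun t ht => hasDerivAt_comp_line (hG _ ht))
      (fun t ht hne => hasDerivAt_inner_comp_line (hH _ ⟨ht, ht₀ t hne⟩))
      (fun t ht hne => hpos _ ⟨ht, ht₀ t hne⟩ _)
    have h := hc.2 (x := 0) (by simpa using hx) (y := 1) (by simpa using hy) ha hb hab
    have he : x + b • (y - x) = a • x + b • y := by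
      rw [← eq_sub_iff_add_eq] at hab
      subst hab
      module
    simpa [he] using h

/-- The gradient inequality, up to the boundary of the domain of convexity. -/
theorem _root_.ConvexOn.add_inner_gradient_le [CompleteSpace E] {D : Set E} {φ : E → ℝ}
    (hφ : ConvexOn ℝ D φ) {x z G : E} (hx : x ∈ D) (hz : z ∈ D) (hG : HasGradientAt φ G x) :
    φ x + inner ℝ G (z - x) ≤ φ z := by
  have h := (convexOn_comp_line hφ x (z - x)).le_slope_of_hasDerivAt (x := 0) (y := 1)
    (by simpa using hx) (by simpa using hz) one_pos
    (hasDerivAt_comp_line (by simpa using hG))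
  simp [slope] at h
  linarith

/-! ### Loewner order and inversion -/

/-- Expansion of the square `⟨B (B⁻¹ v - s y), B⁻¹ v - s y⟩ ≥ 0`, for a positive semidefinite
invertible `B`. Inversion of Loewner inequalities follows by a choice of `s` and `y`. -/
theorem inner_symm_sub_smul_nonneg {B : E ≃L[ℝ] E} (hB : ∀ v, 0 ≤ (inner ℝ (B v) v : ℝ))
    (hBs : ∀ u v, (inner ℝ (B u) v : ℝ) = inner ℝ u (B v)) (v y : E) (s : ℝ) :
    0 ≤ (inner ℝ (B.symm v) v : ℝ) - 2 * s * inner ℝ y v + s ^ 2 * inner ℝ (B y) y := by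
  have h := hB (B.symm v - s • y)
  have h2 : (inner ℝ (B y) (B.symm v) : ℝ) = inner ℝ y v := by
    rw [hBs, B.apply_symm_apply]
  simp only [map_sub, map_smul, B.apply_symm_apply, inner_sub_left, inner_sub_right,
    inner_smul_left, inner_smul_right, h2, RCLike.conj_to_real] at h
  rw [real_inner_comm v (B.symm v), real_inner_comm v y]
  rw [real_inner_comm v y] at h
  linarith

/-- If `B ≤ c A` with `c ≥ 0`, then `A⁻¹ ≤ c B⁻¹`, where `A` and `B` are invertible and `B` is
positive semidefinite. -/
theorem inner_symm_le_mul_inner_symm {A B : E ≃L[ℝ] E} {c : ℝ} (hc : 0 ≤ c)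
    (hB : ∀ v, 0 ≤ (inner ℝ (B v) v : ℝ))
    (hBs : ∀ u v, (inner ℝ (B u) v : ℝ) = inner ℝ u (B v))
    (h : ∀ v, (inner ℝ (B v) v : ℝ) ≤ c * inner ℝ (A v) v) (v : E) :
    (inner ℝ (A.symm v) v : ℝ) ≤ c * inner ℝ (B.symm v) v := by
  set α : ℝ := inner ℝ (A.symm v) v
  set β : ℝ := inner ℝ (B.symm v) v
  have key : ∀ s : ℝ, 0 ≤ β - 2 * s * α + s ^ 2 * (c * α) := by
    intro s
    have h1 := inner_symm_sub_smul_nonneg hB hBs v (A.symm v) s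
    have h2 := h (A.symm v)
    rw [A.apply_symm_apply, real_inner_comm (A.symm v) v] at h2
    have h3 := mul_le_mul_of_nonneg_left h2 (sq_nonneg s)
    linarith
  rcases hc.eq_or_lt with rfl | hc
  · -- the square is now affine in `s`, hence of slope `0`
    by_contra! hα
    rw [zero_mul] at hα
    have h1 := key ((β + 1) / (2 * α))
    have h2 : 2 * ((β + 1) / (2 * α)) * α = β + 1 := by field_simp
    rw [h2] at h1
    linarith
  · have h1 := key c⁻¹
    have h2 : c * (β - 2 * c⁻¹ * α + c⁻¹ ^ 2 * (c * α)) = c * β - α := by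
      field_simp
      ring
    have h3 := mul_nonneg hc.le h1
    linarith

/-- If `c A ≤ B`, then `c B⁻¹ ≤ A⁻¹`, where `A` and `B` are invertible and `A` is positive
semidefinite. -/
theorem mul_inner_symm_le_inner_symm {A B : E ≃L[ℝ] E} {c : ℝ} (hc : 0 ≤ c)
    (hA : ∀ v, 0 ≤ (inner ℝ (A v) v : ℝ))
    (hAs : ∀ u v, (inner ℝ (A u) v : ℝ) = inner ℝ u (A v))
    (h : ∀ v, c * inner ℝ (A v) v ≤ (inner ℝ (B v) v : ℝ)) (v : E) :
    c * inner ℝ (B.symm v) v ≤ (inner ℝ (A.symm v) v : ℝ) := by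
  have h1 := inner_symm_sub_smul_nonneg hA hAs v (B.symm v) c
  have h2 := mul_le_mul_of_nonneg_left (h (B.symm v)) hc
  rw [B.apply_symm_apply, real_inner_comm (B.symm v) v] at h2
  linarith

end Hilbert

variable {d : ℕ}

/-! ### Real representatives of extended-real-valued convex functions -/

theorem IsProper.coe_re {f : Eucl d → EReal} (hf : IsProper f) {x : Eucl d} (hx : x ∈ dom f) :
    ((re f x : ℝ) : EReal) = f x :=
  EReal.coe_toReal (ne_of_lt hx) (hf.1 x)

theorem convexOn_re {f : Eucl d → EReal} (hf : ∀ x, f x ≠ ⊥) (hc : IsConvex f) :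
    ConvexOn ℝ (dom f) (re f) := by
  rw [convexOn_iff_convex_epigraph]
  have : {p : Eucl d × ℝ | p.1 ∈ dom f ∧ re f p.1 ≤ p.2} =
      {p : Eucl d × ℝ | f p.1 ≤ (p.2 : EReal)} := by
    ext ⟨x, t⟩
    constructor
    · rintro ⟨hx, h⟩
      have hx' : ((re f x : ℝ) : EReal) = f x := EReal.coe_toReal (ne_of_lt hx) (hf x)
      change f x ≤ t
      rw [← hx']
      exact_mod_cast h
    · intro h
      have hx : x ∈ dom f := lt_of_le_of_lt h (EReal.coe_lt_top t)
      have hx' : ((re f x : ℝ) : EReal) = f x := EReal.coe_toReal (ne_of_lt hx) (hf x)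
      refine ⟨hx, ?_⟩
      change f x ≤ t at h
      rw [← hx'] at h
      exact_mod_cast h
  rw [this]
  exact hc

open Classical in
theorem isConvex_ite_iff {Q : Set (Eucl d)} {h : Eucl d → EReal} {r : Eucl d → ℝ}
    (hr : ∀ x ∈ Q, h x = (r x : EReal)) :
    IsConvex (fun x => if x ∈ Q then h x else ⊤) ↔ ConvexOn ℝ Q r := by
  rw [convexOn_iff_convex_epigraph, IsConvex]
  have : {p : Eucl d × ℝ | (if p.1 ∈ Q then h p.1 else ⊤) ≤ (p.2 : EReal)} =
      {p : Eucl d × ℝ | p.1 ∈ Q ∧ r p.1 ≤ p.2} := by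
    ext ⟨x, t⟩
    by_cases hx : x ∈ Q
    · simp [hx, hr x hx]
    · simp [hx]
  rw [this]

theorem IsEssentiallySmooth.hasGradientAt {f : Eucl d → EReal} (hf : IsEssentiallySmooth f)
    {x : Eucl d} (hx : x ∈ interior (dom f)) : HasGradientAt (re f) (grad f x) x :=
  (hf.differentiable x hx).hasGradientAt

theorem IsEssentiallySmooth.convexOn {f : Eucl d → EReal} (hf : IsEssentiallySmooth f) :
    ConvexOn ℝ (dom f) (re f) :=
  convexOn_re hf.proper.1 hf.convex

/-! ### Subgradients of essentially smooth functions -/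

/-- `y` is a subgradient of `f` at the point `x` of `dom f`. -/
def IsSubgradientAt (f : Eucl d → EReal) (y x : Eucl d) : Prop :=
  x ∈ dom f ∧ ∀ z ∈ dom f, re f x + inner ℝ y (z - x) ≤ re f z

theorem IsEssentiallySmooth.isSubgradientAt_grad {f : Eucl d → EReal}
    (hf : IsEssentiallySmooth f) {x : Eucl d} (hx : x ∈ interior (dom f)) :
    IsSubgradientAt f (grad f x) x :=
  ⟨interior_subset hx, fun _ hz =>
    hf.convexOn.add_inner_gradient_le (interior_subset hx) hz (hf.hasGradientAt hx)⟩

/-- An essentially smooth function has no subgradient at a boundary point `b` of its domain: if it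
had one, the gradients along a segment from `b` to an interior point `a` would be bounded. -/
theorem IsEssentiallySmooth.mem_interior_of_isSubgradientAt {f : Eucl d → EReal}
    (hf : IsEssentiallySmooth f) {y b : Eucl d} (h : IsSubgradientAt f y b) :
    b ∈ interior (dom f) := by
  by_contra hb
  obtain ⟨a, ha⟩ := hf.nonempty_interior
  have hconv := hf.convexOn
  -- an upper bound for `f` near `a`
  obtain ⟨r, hr, hball⟩ : ∃ r > 0, ∀ z ∈ Metric.closedBall a r,
      z ∈ dom f ∧ re f z ≤ re f a + 1 := by
    have h1 : ∀ᶠ z in 𝓝 a, re f z < re f a + 1 :=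
      (hf.differentiable a ha).continuousAt.eventually (gt_mem_nhds (by linarith))
    have h2 : ∀ᶠ z in 𝓝 a, z ∈ dom f := mem_interior_iff_mem_nhds.1 ha
    obtain ⟨r, hr, H⟩ := Metric.nhds_basis_closedBall.eventually_iff.1 (h2.and h1)
    exact ⟨r, hr, fun z hz => ⟨(H hz).1, (H hz).2.le⟩⟩
  set t : ℕ → ℝ := fun n => 1 / ((n : ℝ) + 1) with ht
  have ht0 : ∀ n, 0 < t n := fun n => by positivity
  have ht1 : ∀ n, t n ≤ 1 := fun n => by
    simp only [ht]
    rw [div_le_one (by positivity)]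
    linarith [n.cast_nonneg (α := ℝ)]
  set x : ℕ → Eucl d := fun n => b + t n • (a - b) with hx
  have hxi : ∀ n, x n ∈ interior (dom f) := fun n =>
    hconv.1.add_smul_sub_mem_interior h.1 ha ⟨ht0 n, ht1 n⟩
  have hlim : Tendsto x atTop (𝓝 b) := by
    have h1 : Tendsto t atTop (𝓝 0) := tendsto_one_div_add_atTop_nhds_zero_nat
    simpa using (h1.smul_const (a - b)).const_add b
  have hfr : b ∈ frontier (interior (dom f)) := by
    rw [frontier, interior_interior]
    exact ⟨mem_closure_of_tendsto hlim (Eventually.of_forall hxi), hb⟩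
  have hsteep := hf.steep x b hxi hfr hlim
  have hbound : ∀ n, ‖grad f (x n)‖ ≤ (re f a + 1 - re f b - inner ℝ y (a - b)) / r := by
    intro n
    set g := grad f (x n)
    have hsub := hf.isSubgradientAt_grad (hxi n)
    have h1 := hsub.2 b h.1
    have h2 := h.2 (x n) (interior_subset (hxi n))
    have e1 : b - x n = -(t n • (a - b)) := by simp [hx]
    have e2 : x n - b = t n • (a - b) := by simp [hx]
    rw [e1, inner_neg_right, inner_smul_right] at h1
    rw [e2, inner_smul_right] at h2
    have h3 : (inner ℝ y (a - b) : ℝ) ≤ inner ℝ g (a - b) :=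
      le_of_mul_le_mul_left (by linarith) (ht0 n)
    -- the test point on the sphere around `a` in the direction of the gradient
    obtain ⟨u, hu, hgu⟩ : ∃ u : Eucl d, ‖u‖ ≤ 1 ∧ (inner ℝ g u : ℝ) = ‖g‖ := by
      rcases eq_or_ne g 0 with h0 | h0
      · exact ⟨0, by simp, by simp [h0]⟩
      · refine ⟨‖g‖⁻¹ • g, ?_, ?_⟩
        · rw [norm_smul, norm_inv, norm_norm, inv_mul_cancel₀ (norm_ne_zero_iff.2 h0)]
        · rw [inner_smul_right, real_inner_self_eq_norm_sq]
          field_simp [norm_ne_zero_iff.2 h0]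
    have hz : a + r • u ∈ Metric.closedBall a r := by
      rw [mem_closedBall_iff_norm, add_sub_cancel_left, norm_smul, Real.norm_of_nonneg hr.le]
      exact mul_le_of_le_one_right hr.le hu
    have h4 := hsub.2 _ (hball _ hz).1
    have h5 := (hball _ hz).2
    have e3 : a + r • u - x n = (1 - t n) • (a - b) + r • u := by
      simp only [hx]
      module
    rw [e3, inner_add_right, inner_smul_right, inner_smul_right, hgu] at h4
    have h6 := mul_le_mul_of_nonneg_left h3 (sub_nonneg.2 (ht1 n))
    rw [le_div_iff₀ hr]
    linarith
  obtain ⟨n, hn⟩ := (hsteep.eventually (eventually_gt_atTop _)).exists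
  exact absurd (hbound n) (not_le.2 hn)

theorem IsEssentiallySmooth.grad_eq_of_isSubgradientAt {f : Eucl d → EReal}
    (hf : IsEssentiallySmooth f) {y x : Eucl d} (h : IsSubgradientAt f y x) :
    grad f x = y := by
  have hx := hf.mem_interior_of_isSubgradientAt h
  have hg := hf.hasGradientAt hx
  have hy : HasGradientAt (fun z => 1 * re f z + (-1) * inner ℝ y z)
      ((1 : ℝ) • grad f x + (-1 : ℝ) • y) x :=
    hasGradientAt_lincomb hg ((InnerProductSpace.toDual ℝ (Eucl d) y).hasFDerivAt) 1 (-1)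
  have hmin : IsLocalMin (fun z => 1 * re f z + (-1) * inner ℝ y z) x := by
    filter_upwards [mem_interior_iff_mem_nhds.1 hx] with z hz
    have := h.2 z hz
    rw [inner_sub_right] at this
    linarith
  have := hmin.hasFDerivAt_eq_zero hy.hasFDerivAt
  rw [map_eq_zero_iff _ (InnerProductSpace.toDual ℝ (Eucl d)).injective] at this
  rwa [one_smul, neg_one_smul, ← sub_eq_add_neg, sub_eq_zero] at this

/-! ### The conjugate function -/

theorem conj_le_coe_iff {f : Eucl d → EReal} (hf : IsProper f) {y : Eucl d} {C : ℝ} :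
    conj f y ≤ (C : EReal) ↔ ∀ x ∈ dom f, inner ℝ x y - re f x ≤ C := by
  rw [conj, iSup₂_le_iff]
  refine forall₂_congr fun x hx => ?_
  rw [← hf.coe_re hx, ← EReal.coe_sub, EReal.coe_le_coe_iff]

theorem conj_ne_bot {f : Eucl d → EReal} (hf : IsProper f) (y : Eucl d) : conj f y ≠ ⊥ := by
  obtain ⟨x, hx⟩ := hf.2
  have hx' : x ∈ dom f := lt_top_iff_ne_top.2 hx
  intro h
  have h1 : ((inner ℝ x y : ℝ) : EReal) - f x ≤ conj f y :=
    le_iSup₂ (f := fun (x : Eucl d) (_ : x ∈ dom f) => ((inner ℝ x y : ℝ) : EReal) - f x) x hx'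
  rw [h, ← hf.coe_re hx', ← EReal.coe_sub, le_bot_iff] at h1
  exact EReal.coe_ne_bot _ h1

theorem coe_re_conj {f : Eucl d → EReal} (hf : IsProper f) {y : Eucl d}
    (hy : y ∈ dom (conj f)) : ((re (conj f) y : ℝ) : EReal) = conj f y :=
  EReal.coe_toReal (ne_of_lt hy) (conj_ne_bot hf y)

theorem mem_dom_conj {f : Eucl d → EReal} (hf : IsProper f) {y : Eucl d} {C : ℝ}
    (h : ∀ x ∈ dom f, inner ℝ x y - re f x ≤ C) : y ∈ dom (conj f) :=
  lt_of_le_of_lt ((conj_le_coe_iff hf).2 h) (EReal.coe_lt_top C)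

theorem re_conj_le_iff {f : Eucl d → EReal} (hf : IsProper f) {y : Eucl d}
    (hy : y ∈ dom (conj f)) {C : ℝ} :
    re (conj f) y ≤ C ↔ ∀ x ∈ dom f, inner ℝ x y - re f x ≤ C := by
  rw [← conj_le_coe_iff hf, ← coe_re_conj hf hy, EReal.coe_le_coe_iff]

/-- The Fenchel–Young inequality. -/
theorem inner_sub_re_le_re_conj {f : Eucl d → EReal} (hf : IsProper f) {x y : Eucl d}
    (hx : x ∈ dom f) (hy : y ∈ dom (conj f)) : inner ℝ x y - re f x ≤ re (conj f) y :=
  (re_conj_le_iff hf hy).1 le_rfl x hx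

theorem convexOn_re_conj {f : Eucl d → EReal} (hf : IsProper f) :
    ConvexOn ℝ (dom (conj f)) (re (conj f)) := by
  have key : ∀ y ∈ dom (conj f), ∀ z ∈ dom (conj f), ∀ a b : ℝ, 0 ≤ a → 0 ≤ b → a + b = 1 →
      ∀ x ∈ dom f, inner ℝ x (a • y + b • z) - re f x ≤
        a • re (conj f) y + b • re (conj f) z := by
    intro y hy z hz a b ha hb hab x hx
    have h1 := mul_le_mul_of_nonneg_left (inner_sub_re_le_re_conj hf hx hy) ha
    have h2 := mul_le_mul_of_nonneg_left (inner_sub_re_le_re_conj hf hx hz) hb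
    rw [inner_add_right, inner_smul_right, inner_smul_right, smul_eq_mul, smul_eq_mul]
    have h3 : re f x = a * re f x + b * re f x := by rw [← add_mul, hab, one_mul]
    linarith
  refine ⟨fun y hy z hz a b ha hb hab => mem_dom_conj hf (key y hy z hz a b ha hb hab),
    fun y hy z hz a b ha hb hab => ?_⟩
  exact (re_conj_le_iff hf (mem_dom_conj hf (key y hy z hz a b ha hb hab))).2
    (key y hy z hz a b ha hb hab)

/-- Equality in the Fenchel–Young inequality. -/
theorem IsSubgradientAt.re_conj {f : Eucl d → EReal} (hf : IsProper f) {x y : Eucl d}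
    (h : IsSubgradientAt f y x) :
    y ∈ dom (conj f) ∧ re (conj f) y = inner ℝ x y - re f x := by
  have key : ∀ z ∈ dom f, inner ℝ z y - re f z ≤ inner ℝ x y - re f x := by
    intro z hz
    have := h.2 z hz
    rw [inner_sub_right, real_inner_comm, real_inner_comm x y] at this
    linarith
  have hy := mem_dom_conj hf key
  exact ⟨hy, le_antisymm ((re_conj_le_iff hf hy).2 key) (inner_sub_re_le_re_conj hf h.1 hy)⟩

/-- At an interior point `y` of `dom f^*`, the function `f - ⟨·, y⟩` is coercive, hence attains its
minimum: `y` is a subgradient of `f` somewhere. -/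
theorem exists_isSubgradientAt {f : Eucl d → EReal} (hf : IsProper f)
    (hlsc : LowerSemicontinuous f) {y : Eucl d} (hy : y ∈ interior (dom (conj f))) :
    ∃ x, IsSubgradientAt f y x := by
  -- `f^*` is bounded above by some `C` on a ball of radius `ε` around `y`
  obtain ⟨ε, hε, C, hC⟩ : ∃ ε > 0, ∃ C : ℝ, ∀ z ∈ Metric.closedBall y ε,
      z ∈ dom (conj f) ∧ re (conj f) z ≤ C := by
    have h1 : ContinuousAt (re (conj f)) y :=
      ((convexOn_re_conj hf).continuousOn_interior).continuousAt (isOpen_interior.mem_nhds hy)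
    have h2 : ∀ᶠ z in 𝓝 y, re (conj f) z < re (conj f) y + 1 :=
      h1.eventually (gt_mem_nhds (by linarith))
    have h3 : ∀ᶠ z in 𝓝 y, z ∈ dom (conj f) := mem_interior_iff_mem_nhds.1 hy
    obtain ⟨r, hr, H⟩ := Metric.nhds_basis_closedBall.eventually_iff.1 (h3.and h2)
    exact ⟨r, hr, _, fun z hz => ⟨(H hz).1, (H hz).2.le⟩⟩
  have hcoer : ∀ z ∈ dom f, ε * ‖z‖ - C ≤ re f z - inner ℝ z y := by
    intro z hz
    obtain ⟨u, hu, hzu⟩ : ∃ u : Eucl d, ‖u‖ ≤ 1 ∧ (inner ℝ z u : ℝ) = ‖z‖ := by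
      rcases eq_or_ne z 0 with h0 | h0
      · exact ⟨0, by simp, by simp [h0]⟩
      · refine ⟨‖z‖⁻¹ • z, ?_, ?_⟩
        · rw [norm_smul, norm_inv, norm_norm, inv_mul_cancel₀ (norm_ne_zero_iff.2 h0)]
        · rw [inner_smul_right, real_inner_self_eq_norm_sq]
          field_simp [norm_ne_zero_iff.2 h0]
    have hm : y + ε • u ∈ Metric.closedBall y ε := by
      rw [mem_closedBall_iff_norm, add_sub_cancel_left, norm_smul, Real.norm_of_nonneg hε.le]
      exact mul_le_of_le_one_right hε.le hu
    have h1 := inner_sub_re_le_re_conj hf hz (hC _ hm).1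
    have h2 := (hC _ hm).2
    rw [inner_add_right, inner_smul_right, hzu] at h1
    linarith
  obtain ⟨a, ha⟩ := hf.2
  have ha' : a ∈ dom f := lt_top_iff_ne_top.2 ha
  set R : ℝ := max ‖a‖ ((re f a - inner ℝ a y + C) / ε) with hR
  -- the minimum over a large ball of the tilted function
  set g : Eucl d → EReal := fun z => f z + ((-inner ℝ z y : ℝ) : EReal) with hg
  have hglsc : LowerSemicontinuous g := by
    refine LowerSemicontinuous.add' hlsc ?_ ?_
    · exact (continuous_coe_real_ereal.comp (by fun_prop)).lowerSemicontinuous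
    · intro z
      exact EReal.continuousAt_add (Or.inr (EReal.coe_ne_bot _)) (Or.inr (EReal.coe_ne_top _))
  obtain ⟨x, -, hx⟩ := (hglsc.lowerSemicontinuousOn (Metric.closedBall 0 R)).exists_isMinOn
    ⟨a, by simp [hR]⟩ (isCompact_closedBall 0 R)
  have hgre : ∀ z ∈ dom f, g z = ((re f z - inner ℝ z y : ℝ) : EReal) := by
    intro z hz
    simp only [hg]
    rw [← hf.coe_re hz, ← EReal.coe_add, sub_eq_add_neg]
  have hxa : g x ≤ g a := hx (by simp [hR])
  have hxd : x ∈ dom f := by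
    by_contra hxd
    have hxt : f x = ⊤ := by simpa [dom] using hxd
    rw [hgre a ha'] at hxa
    simp only [hg, hxt, EReal.top_add_coe] at hxa
    exact EReal.coe_ne_top _ (top_le_iff.1 hxa)
  have hxa' : re f x - inner ℝ x y ≤ re f a - inner ℝ a y := by
    rw [hgre a ha', hgre x hxd] at hxa
    exact_mod_cast hxa
  refine ⟨x, hxd, fun z hz => ?_⟩
  suffices h : re f x - inner ℝ x y ≤ re f z - inner ℝ z y by
    rw [inner_sub_right, real_inner_comm z y, real_inner_comm x y]
    linarith
  by_cases hzR : ‖z‖ ≤ R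
  · have h1 : g x ≤ g z := hx (by simpa using hzR)
    rw [hgre z hz, hgre x hxd] at h1
    exact_mod_cast h1
  · have h1 : (re f a - inner ℝ a y + C) / ε < ‖z‖ :=
      lt_of_le_of_lt (le_max_right _ _) (not_le.1 hzR)
    rw [div_lt_iff₀ hε] at h1
    have h2 := hcoer z hz
    linarith

/-! ### Legendre duality: the gradient of the conjugate inverts the gradient -/

theorem IsLegendre.add_inner_grad_lt {f : Eucl d → EReal} (hf : IsLegendre f) {x z : Eucl d}
    (hx : x ∈ interior (dom f)) (hz : z ∈ interior (dom f)) (hne : z ≠ x) :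
    re f x + inner ℝ (grad f x) (z - x) < re f z := by
  obtain ⟨hconv, hstrict⟩ := hf.strictConvex
  have h1 := hstrict hx hz hne.symm (a := 1 / 2) (b := 1 / 2) (by norm_num)
    (by norm_num) (by norm_num)
  have hw := hconv hx hz (a := 1 / 2) (b := 1 / 2) (by norm_num)
    (by norm_num) (by norm_num)
  have h2 := (hf.isSubgradientAt_grad hx).2 _ (interior_subset hw)
  have e : (1 / 2 : ℝ) • x + (1 / 2 : ℝ) • z - x = (1 / 2 : ℝ) • (z - x) := by module
  rw [e, inner_smul_right] at h2
  simp only [smul_eq_mul] at h1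
  linarith

/-- Away from `x`, a Legendre function exceeds its affine minorant at `x` by an amount growing
linearly. The slope is the minimum of the gap over a small sphere, and convexity propagates it
outwards. -/
theorem IsLegendre.exists_linear_growth {f : Eucl d → EReal} (hf : IsLegendre f) {x : Eucl d}
    {r : ℝ} (hr : 0 < r) (hball : Metric.closedBall x r ⊆ interior (dom f)) :
    ∃ m > 0, ∀ z ∈ dom f, r ≤ ‖z - x‖ →
      m * ‖z - x‖ ≤ re f z - re f x - inner ℝ (grad f x) (z - x) := by
  have hx : x ∈ interior (dom f) := hball (Metric.mem_closedBall_self hr.le)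
  have hcont : ContinuousOn (fun z => re f z - re f x - inner ℝ (grad f x) (z - x))
      (Metric.sphere x r) := by
    have h1 : ContinuousOn (re f) (Metric.sphere x r) := fun z hz =>
      (hf.differentiable z
        (hball (Metric.sphere_subset_closedBall hz))).continuousAt.continuousWithinAt
    exact (h1.sub continuousOn_const).sub (by fun_prop)
  obtain ⟨m, hm, hmin⟩ := (isCompact_sphere x r).exists_forall_le' hcont (a := 0) fun z hz => by
    have hne : z ≠ x := Metric.ne_of_mem_sphere hz hr.ne'
    have := hf.add_inner_grad_lt hx (hball (Metric.sphere_subset_closedBall hz)) hne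
    linarith
  refine ⟨m / r, div_pos hm hr, fun z hz hzr => ?_⟩
  have hpos : 0 < ‖z - x‖ := hr.trans_le hzr
  -- the point `w` of the sphere on the segment from `x` to `z`
  set s : ℝ := r / ‖z - x‖ with hs
  have hs0 : 0 < s := div_pos hr hpos
  have hs1 : s ≤ 1 := (div_le_one hpos).2 hzr
  have hw : (1 - s) • x + s • z ∈ Metric.sphere x r := by
    have e : (1 - s) • x + s • z - x = s • (z - x) := by module
    rw [mem_sphere_iff_norm, e, norm_smul, Real.norm_of_nonneg hs0.le, hs,
      div_mul_cancel₀ _ hpos.ne']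
  have h1 := hmin _ hw
  have h2 := hf.convexOn.2 (interior_subset hx) hz (sub_nonneg.2 hs1) hs0.le (by ring)
  have e : (1 - s) • x + s • z - x = s • (z - x) := by module
  rw [e, inner_smul_right] at h1
  simp only [smul_eq_mul] at h2
  have h3 : m ≤ s * (re f z - re f x - inner ℝ (grad f x) (z - x)) := by linarith
  rw [hs, div_mul_eq_mul_div, le_div_iff₀ hpos] at h3
  rw [div_mul_eq_mul_div, div_le_iff₀ hr]
  linarith

theorem IsLegendre.grad_mem_interior_dom_conj {f : Eucl d → EReal} (hf : IsLegendre f)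
    {x : Eucl d} (hx : x ∈ interior (dom f)) : grad f x ∈ interior (dom (conj f)) := by
  obtain ⟨r, hr, hball⟩ := Metric.nhds_basis_closedBall.mem_iff.1 (isOpen_interior.mem_nhds hx)
  obtain ⟨m, hm, hgrow⟩ := hf.exists_linear_growth hr hball
  rw [mem_interior_iff_mem_nhds]
  refine Filter.mem_of_superset (Metric.ball_mem_nhds _ hm) fun y hy => ?_
  rw [mem_ball_iff_norm] at hy
  refine mem_dom_conj hf.proper (C := inner ℝ x y - re f x + r * m) fun z hz => ?_
  have e : (inner ℝ z y : ℝ) = inner ℝ x y + inner ℝ (grad f x) (z - x) +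
      inner ℝ (z - x) (y - grad f x) := by
    rw [inner_sub_right (z - x), real_inner_comm (grad f x), inner_sub_left z x y]
    ring
  have h1 : (inner ℝ (z - x) (y - grad f x) : ℝ) ≤ ‖z - x‖ * m :=
    (real_inner_le_norm _ _).trans (mul_le_mul_of_nonneg_left hy.le (norm_nonneg _))
  have h2 := (hf.isSubgradientAt_grad hx).2 z hz
  rcases le_total r ‖z - x‖ with h | h
  · have h3 := hgrow z hz h
    have h4 := mul_pos hr hm
    linarith
  · have h3 := mul_le_mul_of_nonneg_right h hm.le
    linarith

/-- The inverse of the gradient map is continuous. -/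
theorem IsLegendre.norm_sub_lt_of_isSubgradientAt {f : Eucl d → EReal} (hf : IsLegendre f)
    {x : Eucl d} (hx : x ∈ interior (dom f)) {ε : ℝ} (hε : 0 < ε) :
    ∃ δ > 0, ∀ x' y', IsSubgradientAt f y' x' → ‖y' - grad f x‖ < δ → ‖x' - x‖ < ε := by
  obtain ⟨r₀, hr₀, hball⟩ :=
    Metric.nhds_basis_closedBall.mem_iff.1 (isOpen_interior.mem_nhds hx)
  have hr : 0 < min r₀ ε := lt_min hr₀ hε
  obtain ⟨m, hm, hgrow⟩ := hf.exists_linear_growth hr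
    ((Metric.closedBall_subset_closedBall (min_le_left _ _)).trans hball)
  refine ⟨m, hm, fun x' y' h hy => ?_⟩
  by_contra! hle
  have hpos : 0 < ‖x' - x‖ := hε.trans_le hle
  have h1 := hgrow x' h.1 ((min_le_right _ _).trans hle)
  have h2 := h.2 x (interior_subset hx)
  have h3 : (inner ℝ (y' - grad f x) (x' - x) : ℝ) ≤ ‖y' - grad f x‖ * ‖x' - x‖ :=
    real_inner_le_norm _ _
  have h4 := mul_lt_mul_of_pos_right hy hpos
  rw [← neg_sub x' x, inner_neg_right] at h2
  rw [inner_sub_left] at h3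
  linarith

/-- The increment of `f^*` from `y = ∇f(x)` to `y'` exceeds its linear part `⟨x, y' - y⟩` by at
most `⟨x' - x, y' - y⟩`, where `y' = ∇f(x')`, and `x'` tends to `x` as `y'` tends to `y`. -/
theorem IsLegendre.hasGradientAt_conj {f : Eucl d → EReal} (hf : IsLegendre f) {x : Eucl d}
    (hx : x ∈ interior (dom f)) : HasGradientAt (re (conj f)) x (grad f x) := by
  rw [hasGradientAt_iff_isLittleO, Asymptotics.isLittleO_iff]
  intro c hc
  obtain ⟨δ, hδ, H⟩ := hf.norm_sub_lt_of_isSubgradientAt hx hc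
  have hy := hf.grad_mem_interior_dom_conj hx
  filter_upwards [isOpen_interior.mem_nhds hy, Metric.ball_mem_nhds _ hδ] with y' hy' hball
  obtain ⟨x', hx'⟩ := exists_isSubgradientAt hf.proper hf.closed hy'
  have hxx := H x' y' hx' (mem_ball_iff_norm.1 hball)
  have e1 := ((hf.isSubgradientAt_grad hx).re_conj hf.proper).2
  have e2 := (hx'.re_conj hf.proper).2
  have h1 := inner_sub_re_le_re_conj hf.proper (interior_subset hx) (interior_subset hy')
  have h2 := inner_sub_re_le_re_conj hf.proper hx'.1 (interior_subset hy)
  have h3 : (inner ℝ (x' - x) (y' - grad f x) : ℝ) ≤ c * ‖y' - grad f x‖ :=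
    (real_inner_le_norm _ _).trans (mul_le_mul_of_nonneg_right hxx.le (norm_nonneg _))
  rw [inner_sub_left, inner_sub_right, inner_sub_right] at h3
  rw [Real.norm_eq_abs, abs_of_nonneg (by rw [inner_sub_right]; linarith), inner_sub_right]
  linarith

theorem IsLegendre.grad_conj_grad {f : Eucl d → EReal} (hf : IsLegendre f) {x : Eucl d}
    (hx : x ∈ interior (dom f)) : grad (conj f) (grad f x) = x :=
  (hf.hasGradientAt_conj hx).gradient

theorem IsLegendre.exists_grad_eq {f : Eucl d → EReal} (hf : IsLegendre f) {y : Eucl d}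
    (hy : y ∈ interior (dom (conj f))) : ∃ x ∈ interior (dom f), grad f x = y := by
  obtain ⟨x, hx⟩ := exists_isSubgradientAt hf.proper hf.closed hy
  exact ⟨x, hf.mem_interior_of_isSubgradientAt hx, hf.grad_eq_of_isSubgradientAt hx⟩

theorem IsLegendre.grad_conj_mem {f : Eucl d → EReal} (hf : IsLegendre f) {y : Eucl d}
    (hy : y ∈ interior (dom (conj f))) : grad (conj f) y ∈ interior (dom f) := by
  obtain ⟨x, hx, rfl⟩ := hf.exists_grad_eq hy
  rwa [hf.grad_conj_grad hx]

theorem IsLegendre.grad_grad_conj {f : Eucl d → EReal} (hf : IsLegendre f) {y : Eucl d}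
    (hy : y ∈ interior (dom (conj f))) : grad f (grad (conj f) y) = y := by
  obtain ⟨x, hx, rfl⟩ := hf.exists_grad_eq hy
  rw [hf.grad_conj_grad hx]

theorem IsLegendre.continuousAt_grad_conj {f : Eucl d → EReal} (hf : IsLegendre f)
    {y : Eucl d} (hy : y ∈ interior (dom (conj f))) : ContinuousAt (grad (conj f)) y := by
  obtain ⟨x, hx, rfl⟩ := hf.exists_grad_eq hy
  rw [Metric.continuousAt_iff']
  intro ε hε
  obtain ⟨δ, hδ, H⟩ := hf.norm_sub_lt_of_isSubgradientAt hx hε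
  filter_upwards [isOpen_interior.mem_nhds hy, Metric.ball_mem_nhds _ hδ] with y' hy' hball
  rw [hf.grad_conj_grad hx, dist_eq_norm]
  have h := hf.isSubgradientAt_grad (hf.grad_conj_mem hy')
  rw [hf.grad_grad_conj hy'] at h
  exact H _ _ h (mem_ball_iff_norm.1 hball)

/-- The Hessian of `f^*` at `∇f(x)` is the inverse of the Hessian `e` of `f` at `x`. -/
theorem IsLegendre.hasFDerivAt_grad_conj {f : Eucl d → EReal} (hf : IsLegendre f) {x : Eucl d}
    (hx : x ∈ interior (dom f)) {e : Eucl d ≃L[ℝ] Eucl d}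
    (he : HasFDerivAt (grad f) (e : Eucl d →L[ℝ] Eucl d) x) :
    HasFDerivAt (grad (conj f)) (e.symm : Eucl d →L[ℝ] Eucl d) (grad f x) := by
  have hy := hf.grad_mem_interior_dom_conj hx
  refine HasFDerivAt.of_local_left_inverse (f := grad f) (hf.continuousAt_grad_conj hy) ?_ ?_
  · rwa [hf.grad_conj_grad hx]
  · filter_upwards [isOpen_interior.mem_nhds hy] with y' hy' using hf.grad_grad_conj hy'

/-! ### Hessians of twice continuously differentiable functions -/

theorem IsC2On.hasFDerivAt_grad {h : Eucl d → EReal} {W : Set (Eucl d)} (hh : IsC2On h W)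
    (hW : IsOpen W) {y : Eucl d} (hy : y ∈ W) : HasFDerivAt (grad h) (hess h y) y := by
  have h1 : ContDiffAt ℝ 2 (re h) y := hh.2.contDiffAt (hW.mem_nhds hy)
  have h2 : DifferentiableAt ℝ (fderiv ℝ (re h)) y :=
    (h1.fderiv_right (m := 1) (by norm_num)).differentiableAt (by norm_num)
  have h3 : DifferentiableAt ℝ (grad h) y :=
    (InnerProductSpace.toDual ℝ (Eucl d)).symm.toContinuousLinearEquiv.differentiableAt.comp y h2
  exact h3.hasFDerivAt

theorem IsC2On.inner_hess {h : Eucl d → EReal} {W : Set (Eucl d)} (hh : IsC2On h W)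
    (hW : IsOpen W) {y : Eucl d} (hy : y ∈ W) (u v : Eucl d) :
    (inner ℝ (hess h y u) v : ℝ) = inner ℝ u (hess h y v) := by
  have h1 : ContDiffAt ℝ 2 (re h) y := hh.2.contDiffAt (hW.mem_nhds hy)
  have h2 : DifferentiableAt ℝ (fderiv ℝ (re h)) y :=
    (h1.fderiv_right (m := 1) (by norm_num)).differentiableAt (by norm_num)
  have hs : IsSymmSndFDerivAt ℝ (re h) y := h1.isSymmSndFDerivAt (by simp)
  have key : ∀ u v, (inner ℝ (hess h y u) v : ℝ) = fderiv ℝ (fderiv ℝ (re h)) y u v := by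
    intro u v
    have h3 : HasFDerivAt (fun x => fderiv ℝ (re h) x v)
        ((ContinuousLinearMap.apply ℝ ℝ v).comp (fderiv ℝ (fderiv ℝ (re h)) y)) y :=
      (ContinuousLinearMap.apply ℝ ℝ v).hasFDerivAt.comp y h2.hasFDerivAt
    have h4 : HasFDerivAt (fun x => (inner ℝ v (grad h x) : ℝ))
        ((innerSL ℝ v).comp (hess h y)) y :=
      (innerSL ℝ v).hasFDerivAt.comp y (hh.hasFDerivAt_grad hW hy)
    have e : (fun x => (inner ℝ v (grad h x) : ℝ)) = fun x => fderiv ℝ (re h) x v := by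
      ext x
      rw [real_inner_comm]
      exact inner_gradient_left
    rw [e] at h4
    have := congrArg (fun T : Eucl d →L[ℝ] ℝ => T u) (h4.unique h3)
    simpa [real_inner_comm] using this
  rw [key, real_inner_comm, key]
  exact hs u v

theorem coe_le_coe_iff_inner {A B : Eucl d →L[ℝ] Eucl d}
    (hA : ∀ u v, (inner ℝ (A u) v : ℝ) = inner ℝ u (A v))
    (hB : ∀ u v, (inner ℝ (B u) v : ℝ) = inner ℝ u (B v)) :
    A ≤ B ↔ ∀ v, (inner ℝ (A v) v : ℝ) ≤ inner ℝ (B v) v := by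
  rw [ContinuousLinearMap.le_def, ContinuousLinearMap.isPositive_def]
  constructor
  · intro h v
    have := h.2 v
    simpa [ContinuousLinearMap.reApplyInnerSelf_apply, inner_sub_left] using this
  · intro h
    refine ⟨fun u v => ?_, fun v => ?_⟩
    · simp [inner_sub_left, inner_sub_right, hA u v, hB u v]
    · simpa [ContinuousLinearMap.reApplyInnerSelf_apply, inner_sub_left] using h v

theorem inner_symm_of_inner {e : Eucl d ≃L[ℝ] Eucl d}
    (he : ∀ u v, (inner ℝ (e u) v : ℝ) = inner ℝ u (e v)) (u v : Eucl d) :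
    (inner ℝ (e.symm u) v : ℝ) = inner ℝ u (e.symm v) := by
  have := he (e.symm u) (e.symm v)
  rw [e.apply_symm_apply, e.apply_symm_apply] at this
  exact this.symm

/-! ### Relative smoothness and strong convexity with respect to the conjugate -/

theorem IsLegendre.isSubgradientAt_zero_of_forall_le {f : Eucl d → EReal} (hf : IsLegendre f)
    {xmin : Eucl d} (hmin : ∀ x, f xmin ≤ f x) : IsSubgradientAt f 0 xmin := by
  obtain ⟨a, ha⟩ := hf.proper.2
  have hx : xmin ∈ dom f := (hmin a).trans_lt (lt_top_iff_ne_top.2 ha)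
  refine ⟨hx, fun z hz => ?_⟩
  have := hmin z
  rw [← hf.proper.coe_re hx, ← hf.proper.coe_re hz, EReal.coe_le_coe_iff] at this
  simpa using this

theorem IsConvex.subset_dom_of_diff_singleton {k : Eucl d → EReal} (hbot : ∀ x, k x ≠ ⊥)
    (hk : IsConvex k) (hne : (dom k).Nonempty) {V : Set (Eucl d)} (hV : IsOpen V) {p : Eucl d}
    (h : V \ {p} ⊆ dom k) : V ⊆ dom k := by
  intro y hy
  rcases ne_or_eq y p with hyp | rfl
  · exact h ⟨hy, hyp⟩
  obtain ⟨a, ha⟩ := hne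
  rcases eq_or_ne a y with rfl | hay
  · exact ha
  -- `y` is the midpoint of two other points of `V`
  obtain ⟨r, hr, hball⟩ := Metric.nhds_basis_closedBall.mem_iff.1 (hV.mem_nhds hy)
  have hv : 0 < ‖a - y‖ := norm_pos_iff.2 (sub_ne_zero.2 hay)
  set w : Eucl d := (r / ‖a - y‖) • (a - y) with hw
  have hwn : ‖w‖ = r := by
    rw [hw, norm_smul, Real.norm_of_nonneg (by positivity), div_mul_cancel₀ _ hv.ne']
  have hw0 : w ≠ 0 := by
    rw [← norm_pos_iff, hwn]
    exact hr
  have h1 : y + w ∈ dom k := h ⟨hball (by simp [hwn]), by simpa using hw0⟩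
  have h2 : y - w ∈ dom k := h ⟨hball (by simp [hwn]), by simpa using hw0⟩
  obtain ⟨hconv, -⟩ := convexOn_re hbot hk
  have h3 := hconv h1 h2 (a := 1 / 2) (b := 1 / 2) (by norm_num)
    (by norm_num) (by norm_num)
  have e : (1 / 2 : ℝ) • (y + w) + (1 / 2 : ℝ) • (y - w) = y := by module
  rwa [e] at h3

theorem isRelSmoothOn_iff {h g : Eucl d → EReal} (hh : IsProper h) (hg : ∀ x, g x ≠ ⊥)
    {Q : Set (Eucl d)} (hQ : Convex ℝ Q) (hQh : Q ⊆ dom h) (hQg : Q ⊆ dom g) (L : ℝ) :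
    IsRelSmoothOn L h g Q ↔ ConvexOn ℝ Q (fun y => L * re g y + (-1) * re h y) := by
  have e := isConvex_ite_iff (Q := Q) (h := fun y => (L : EReal) * g y - h y)
    (r := fun y => L * re g y + (-1) * re h y) fun y hy => by
      have h1 : ((re g y : ℝ) : EReal) = g y := EReal.coe_toReal (ne_of_lt (hQg hy)) (hg y)
      rw [← h1, ← hh.coe_re (hQh hy), ← EReal.coe_mul, ← EReal.coe_sub, EReal.coe_eq_coe_iff]
      ring
  rw [IsRelSmoothOn, e]
  exact ⟨fun h => h.2.2, fun h => ⟨subset_inter hQh hQg, hQ, h⟩⟩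

theorem isRelStronglyConvexOn_iff {h g : Eucl d → EReal} (hh : IsProper h)
    (hg : ∀ x, g x ≠ ⊥) {Q : Set (Eucl d)} (hQ : Convex ℝ Q) (hQh : Q ⊆ dom h)
    (hQg : Q ⊆ dom g) (μ : ℝ) :
    IsRelStronglyConvexOn μ h g Q ↔
      ConvexOn ℝ Q (fun y => (-μ) * re g y + 1 * re h y) := by
  have e := isConvex_ite_iff (Q := Q) (h := fun y => h y - (μ : EReal) * g y)
    (r := fun y => (-μ) * re g y + 1 * re h y) fun y hy => by
      have h1 : ((re g y : ℝ) : EReal) = g y := EReal.coe_toReal (ne_of_lt (hQg hy)) (hg y)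
      rw [← h1, ← hh.coe_re (hQh hy), ← EReal.coe_mul, ← EReal.coe_sub, EReal.coe_eq_coe_iff]
      ring
  rw [IsRelStronglyConvexOn, e]
  exact ⟨fun h => h.2.2, fun h => ⟨subset_inter hQh hQg, hQ, h⟩⟩

theorem IsLegendre.inner_hess_nonneg {h : Eucl d → EReal} (hh : IsLegendre h)
    {V : Set (Eucl d)} (hVo : IsOpen V) (hV : Convex ℝ V) (hVd : V ⊆ interior (dom h))
    {p : Eucl d} (hC2 : IsC2On h (V \ {p})) {y : Eucl d} (hy : y ∈ V \ {p}) (v : Eucl d) :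
    0 ≤ (inner ℝ (hess h y v) v : ℝ) :=
  (convexOn_iff_hessian_nonneg_off_point hVo hV p
    (fun _ hz => hh.hasGradientAt (hVd hz))
    (fun _ hz => hC2.hasFDerivAt_grad (hVo.sdiff isClosed_singleton) hz)).1
    (hh.convexOn.subset (hVd.trans interior_subset) hV) y hy v

/-- Convexity of `a f^* + b k` on `int (dom f^*)`, read through the bijection `∇f` from
`int (dom f) \ {xmin}` onto `int (dom f^*) \ {0}`. -/
theorem convexOn_conj_lincomb_iff {f k : Eucl d → EReal} {xmin : Eucl d} (hf : IsLegendre f)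
    (hxmin : xmin ∈ interior (dom f)) (hgrad : grad f xmin = 0)
    (hfC2 : IsC2On f (interior (dom f) \ {xmin}))
    (hfdet : ∀ x ∈ interior (dom f) \ {xmin}, (hess f x).det ≠ 0)
    (hk : IsLegendre k) (hVk : interior (dom (conj f)) ⊆ interior (dom k))
    (hkC2 : IsC2On k (interior (dom (conj f)) \ {0})) (a b : ℝ) :
    ConvexOn ℝ (interior (dom (conj f))) (fun y => a * re (conj f) y + b * re k y) ↔
      ∀ x ∈ interior (dom f) \ {xmin}, ∀ v : Eucl d,
        0 ≤ a * (inner ℝ ((hess f x).inverse v) v : ℝ) +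
          b * inner ℝ (hess k (grad f x) v) v := by
  have hiff : ∀ x ∈ interior (dom f), grad f x = 0 ↔ x = xmin := by
    intro x hx
    refine ⟨fun h => ?_, fun h => h ▸ hgrad⟩
    rw [← hf.grad_conj_grad hx, h, ← hgrad, hf.grad_conj_grad hxmin]
  have hW : IsOpen (interior (dom f) \ {xmin}) := isOpen_interior.sdiff isClosed_singleton
  have hW' : IsOpen (interior (dom (conj f)) \ {0}) := isOpen_interior.sdiff isClosed_singleton
  have hmap : ∀ y ∈ interior (dom (conj f)) \ {0},
      grad (conj f) y ∈ interior (dom f) \ {xmin} := by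
    intro y hy
    refine ⟨hf.grad_conj_mem hy.1, fun h => hy.2 ?_⟩
    rw [mem_singleton_iff, ← hf.grad_grad_conj hy.1]
    exact (hiff _ (hf.grad_conj_mem hy.1)).2 h
  have hconj : ∀ y ∈ interior (dom (conj f)) \ {0},
      HasFDerivAt (grad (conj f)) (hess f (grad (conj f) y)).inverse y := by
    intro y hy
    have hx := hmap y hy
    set x := grad (conj f) y with hxy
    set e := (hess f x).toContinuousLinearEquivOfDetNeZero (hfdet x hx) with he
    have hex : (e : Eucl d →L[ℝ] Eucl d) = hess f x :=
      ContinuousLinearMap.coe_toContinuousLinearEquivOfDetNeZero _ _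
    have h := hf.hasFDerivAt_grad_conj hx.1 (e := e)
      (by rw [hex]; exact hfC2.hasFDerivAt_grad hW hx)
    rwa [hxy, hf.grad_grad_conj hy.1, ← ContinuousLinearMap.inverse_equiv, hex] at h
  rw [convexOn_iff_hessian_nonneg_off_point isOpen_interior (convexOn_re_conj hf.proper).1.interior 0
    (G := fun y => a • grad (conj f) y + b • grad k y)
    (H := fun y => a • (hess f (grad (conj f) y)).inverse + b • hess k y)]
  · constructor
    · intro h x hx v
      have := h (grad f x) ⟨hf.grad_mem_interior_dom_conj hx.1,
        fun h0 => hx.2 ((hiff x hx.1).1 h0)⟩ v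
      simpa [hf.grad_conj_grad hx.1, inner_add_left, inner_smul_left] using this
    · intro h y hy v
      have := h _ (hmap y hy) v
      rw [hf.grad_grad_conj hy.1] at this
      simpa [inner_add_left, inner_smul_left] using this
  · intro y hy
    have h1 := hf.hasGradientAt_conj (hf.grad_conj_mem hy)
    rw [hf.grad_grad_conj hy] at h1
    exact hasGradientAt_lincomb h1 (hk.hasGradientAt (hVk hy)) a b
  · intro y hy
    exact ((hconj y hy).const_smul a).add ((hkC2.hasFDerivAt_grad hW' hy).const_smul b)

end DualPrecond

/-- In the matrix inequalities, `≤` is the Loewner order on operators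
(`A ≤ B` iff `B - A` is symmetric positive semidefinite). -/
theorem mainTheorem3 (d : ℕ) (f k : DualPrecond.Eucl d → EReal) (xmin : DualPrecond.Eucl d)
    (hf : DualPrecond.IsLegendre f)
    (hmin : ∀ x, f xmin ≤ f x)
    (hfC2 : DualPrecond.IsC2On f (interior (DualPrecond.dom f) \ {xmin}))
    (hfdet : ∀ x ∈ interior (DualPrecond.dom f) \ {xmin}, (DualPrecond.hess f x).det ≠ 0)
    (hk : DualPrecond.IsLegendre k)
    (hkC2 : DualPrecond.IsC2On k (interior (DualPrecond.dom (DualPrecond.conj f)) \ {0}))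
    (hkdet : ∀ y ∈ interior (DualPrecond.dom (DualPrecond.conj f)) \ {0},
      (DualPrecond.hess k y).det ≠ 0)
    (Lstar μstar : ℝ) (hL : 0 ≤ Lstar) (hμ : 0 ≤ μstar) :
    (DualPrecond.IsRelSmoothOn Lstar k (DualPrecond.conj f)
        (interior (DualPrecond.dom (DualPrecond.conj f))) ↔
      ∀ x ∈ interior (DualPrecond.dom f) \ {xmin},
        DualPrecond.hess f x ≤
          Lstar • (DualPrecond.hess k (DualPrecond.grad f x)).inverse) ∧
    (DualPrecond.IsRelStronglyConvexOn μstar k (DualPrecond.conj f)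
        (interior (DualPrecond.dom (DualPrecond.conj f))) ↔
      ∀ x ∈ interior (DualPrecond.dom f) \ {xmin},
        μstar • (DualPrecond.hess k (DualPrecond.grad f x)).inverse ≤
          DualPrecond.hess f x) := by
  open DualPrecond in
  have hsub := hf.isSubgradientAt_zero_of_forall_le hmin
  have hxmin := hf.mem_interior_of_isSubgradientAt hsub
  have hgrad : grad f xmin = 0 := hf.grad_eq_of_isSubgradientAt hsub
  have hVconv : Convex ℝ (interior (dom (conj f))) := (convexOn_re_conj hf.proper).1.interior
  have hVk : interior (dom (conj f)) ⊆ dom k :=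
    hk.convex.subset_dom_of_diff_singleton hk.proper.1 (hk.nonempty_interior.mono interior_subset)
      isOpen_interior hkC2.1
  have hVk' : interior (dom (conj f)) ⊆ interior (dom k) := interior_maximal hVk isOpen_interior
  -- the two Hessians at corresponding points, as invertible symmetric positive operators
  have hpair : ∀ x ∈ interior (dom f) \ {xmin}, ∃ A B : Eucl d ≃L[ℝ] Eucl d,
      hess f x = A ∧ hess k (grad f x) = B ∧
      (∀ v, 0 ≤ (inner ℝ (A v) v : ℝ)) ∧ (∀ v, 0 ≤ (inner ℝ (B v) v : ℝ)) ∧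
      (∀ u v, (inner ℝ (A u) v : ℝ) = inner ℝ u (A v)) ∧
      (∀ u v, (inner ℝ (B u) v : ℝ) = inner ℝ u (B v)) := by
    intro x hx
    have hy : grad f x ∈ interior (dom (conj f)) \ {0} := by
      refine ⟨hf.grad_mem_interior_dom_conj hx.1, fun h => hx.2 ?_⟩
      rw [mem_singleton_iff] at h ⊢
      rw [← hf.grad_conj_grad hx.1, h, ← hgrad, hf.grad_conj_grad hxmin]
    refine ⟨(hess f x).toContinuousLinearEquivOfDetNeZero (hfdet x hx),
      (hess k (grad f x)).toContinuousLinearEquivOfDetNeZero (hkdet _ hy),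
      (ContinuousLinearMap.coe_toContinuousLinearEquivOfDetNeZero _ _).symm,
      (ContinuousLinearMap.coe_toContinuousLinearEquivOfDetNeZero _ _).symm, ?_, ?_, ?_, ?_⟩
    · exact hf.inner_hess_nonneg isOpen_interior hf.convexOn.1.interior subset_rfl hfC2 hx
    · exact hk.inner_hess_nonneg isOpen_interior hVconv hVk' hkC2 hy
    · exact hfC2.inner_hess (isOpen_interior.sdiff isClosed_singleton) hx
    · exact hkC2.inner_hess (isOpen_interior.sdiff isClosed_singleton) hy
  have hpos : ∀ A : Eucl d ≃L[ℝ] Eucl d, (∀ v, 0 ≤ (inner ℝ (A v) v : ℝ)) →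
      ∀ v, 0 ≤ (inner ℝ (A.symm v) v : ℝ) := by
    intro A hA v
    have := hA (A.symm v)
    rwa [A.apply_symm_apply, real_inner_comm] at this
  have hsmul : ∀ (c : ℝ) (B : Eucl d ≃L[ℝ] Eucl d),
      (∀ u v, (inner ℝ (B u) v : ℝ) = inner ℝ u (B v)) →
      ∀ u v, (inner ℝ ((c • (B.symm : Eucl d →L[ℝ] Eucl d)) u) v : ℝ) =
        inner ℝ u ((c • (B.symm : Eucl d →L[ℝ] Eucl d)) v) := by
    intro c B hB u v
    simp [inner_smul_left, inner_smul_right, inner_symm_of_inner hB u v]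
  constructor
  · rw [isRelSmoothOn_iff hk.proper (conj_ne_bot hf.proper) hVconv hVk interior_subset,
      convexOn_conj_lincomb_iff hf hxmin hgrad hfC2 hfdet hk hVk' hkC2]
    refine forall₂_congr fun x hx => ?_
    obtain ⟨A, B, hA, hB, hA0, hB0, hAs, hBs⟩ := hpair x hx
    rw [hA, hB, ContinuousLinearMap.inverse_equiv, ContinuousLinearMap.inverse_equiv,
      coe_le_coe_iff_inner hAs (hsmul _ B hBs)]
    simp only [smul_apply, ContinuousLinearEquiv.coe_coe, inner_smul_left,
      RCLike.conj_to_real]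
    constructor
    · intro h
      exact inner_symm_le_mul_inner_symm (A := A.symm) hL hB0 hBs fun v => by linarith [h v]
    · intro h v
      have := inner_symm_le_mul_inner_symm (A := B.symm) hL hA0 hAs h v
      rw [B.symm_symm] at this
      linarith
  · rw [isRelStronglyConvexOn_iff hk.proper (conj_ne_bot hf.proper) hVconv hVk interior_subset,
      convexOn_conj_lincomb_iff hf hxmin hgrad hfC2 hfdet hk hVk' hkC2]
    refine forall₂_congr fun x hx => ?_
    obtain ⟨A, B, hA, hB, hA0, hB0, hAs, hBs⟩ := hpair x hx
    rw [hA, hB, ContinuousLinearMap.inverse_equiv, ContinuousLinearMap.inverse_equiv,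
      coe_le_coe_iff_inner (hsmul _ B hBs) hAs]
    simp only [smul_apply, ContinuousLinearEquiv.coe_coe, inner_smul_left,
      RCLike.conj_to_real]
    constructor
    · intro h
      exact mul_inner_symm_le_inner_symm (A := A.symm) hμ (hpos A hA0) (inner_symm_of_inner hAs)
        fun v => by linarith [h v]
    · intro h v
      have := mul_inner_symm_le_inner_symm (A := B.symm) hμ (hpos B hB0)
        (inner_symm_of_inner hBs) h v
      rw [B.symm_symm] at this
      linarith
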